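/- Let $\varphi$ be a monotone DNF (resp. monotone CNF) on a finite set $V$ of variables, i.e. a disjunction of conjunctions (resp. a conjunction of disjunctions) of variables, given by a finite set of clauses, each being a set of variables; we assume that $\varphi$ has at least one non-empty clause and is minimized (no clause is a strict subset of another). Its hypergraph has vertex set $V$ and the clauses as edges. Let $a$ be its arity (the maximal size of a clause), $d$ its degree (the maximal number of clauses containing a given variable), and $\mathrm{tw}(\varphi)$ the treewidth of the hypergraph. A Boolean circuit on $V$ is a finite directed acyclic graph of gates of type variable, NOT (fan-in 1), AND, OR (arbitrary fan-in, possibly 0), with a designated output gate, and whose variable gates (which have no inputs) are in bijection with $V$. For a gate $g$, let $\mathrm{Vars}(g)$ be the set of variables whose gate has a directed path (possibly of length 0) to $g$. A v-tree over $V$ is a rooted ordered tree whose internal nodes have one or two children and whose leaves are in bijection with $V$. It structures a circuit if for every AND-gate with inputs $g_1,\dots,g_m$, $m>0$ (in some order), there is a node $n$ of the v-tree with exactly $m$ children $n_1,\dots,n_m$ such that, for every $i$, all variables in $\mathrm{Vars}(g_i)$ are leaves of the subtree rooted at $n_i$. An SDNNF is a circuit in which the inputs of NOT-gates are variable gates and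 which is structured by some v-tree over $V$ (so that, in particular, distinct inputs of an AND-gate have disjoint sets $\mathrm{Vars}$). A d-SDNNF is an SDNNF that is deterministic: no two distinct inputs of an OR-gate both evaluate to $1$ under the same valuation of $V$. The size of a circuit is its number of gates. Theorem. Every d-SDNNF (resp. SDNNF) that captures the Boolean function of $\varphi$ has size at least $$2^{\left\lfloor \frac{\mathrm{tw}(\varphi)}{3\,a^3\,d^2}\right\rfloor}-1 .$$ -/

import Mathlib

/-! ### Hypergraphs, arity, degree, treewidth -/

/-- A finite hypergraph on the vertex type `V`: a nonempty finite family of nonempty edges. -/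
structure FinHypergraph (V : Type*) where
  edges : Finset (Finset V)
  edge_nonempty : ∀ e ∈ edges, e.Nonempty
  edges_nonempty : edges.Nonempty

namespace FinHypergraph

variable {V : Type*}

/-- The maximal size of an edge. -/
def arity (H : FinHypergraph V) : ℕ :=
  H.edges.sup Finset.card

/-- The maximal number of edges to which a vertex belongs. -/
def degree [Fintype V] [DecidableEq V] (H : FinHypergraph V) : ℕ :=
  Finset.univ.sup fun v : V => (H.edges.filter fun e => v ∈ e).card

/-- A tree decomposition: a finite tree with nodes labeled by sets of vertices, such that every
edge is contained in some bag and the bags containing a given vertex are connected in the tree.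
(Any node of the tree can be chosen as its root.) -/
structure TreeDecomposition (H : FinHypergraph V) where
  numNodes : ℕ
  tree : SimpleGraph (Fin numNodes)
  isTree : tree.IsTree
  bag : Fin numNodes → Finset V
  edge_subset_bag : ∀ e ∈ H.edges, ∃ b, e ⊆ bag b
  connected_bags : ∀ v : V, (tree.induce {b | v ∈ bag b}).Preconnected

/-- The maximal size of a bag, minus one (some bag is nonempty as it contains an edge). -/
def TreeDecomposition.width {H : FinHypergraph V} (D : H.TreeDecomposition) : ℕ :=
  (Finset.univ.sup fun b => (D.bag b).card) - 1

/-- The minimal width of a tree decomposition. -/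
noncomputable def treewidth (H : FinHypergraph V) : ℕ :=
  sInf (Set.range fun D : H.TreeDecomposition => D.width)

end FinHypergraph

/-! ### Monotone DNFs and CNFs -/

/-- A monotone DNF or CNF on the set of variables `V`, presented by its clauses, each clause being
identified with the set of variables that it contains. It has at least one nonempty clause
and it is minimized: no clause is a strict subset of another. -/
structure MonotoneForm (V : Type*) where
  clauses : Finset (Finset V)
  exists_nonempty : ∃ D ∈ clauses, D.Nonempty
  minimized : ∀ D ∈ clauses, ∀ D' ∈ clauses, D ⊆ D' → D = D'

namespace MonotoneForm

variable {V : Type*}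

/-- The Boolean function of the DNF: the disjunction over clauses of the conjunction of their
variables. -/
def dnfTrue (φ : MonotoneForm V) (ν : V → Bool) : Prop :=
  ∃ D ∈ φ.clauses, ∀ v ∈ D, ν v = true

/-- The Boolean function of the CNF: the conjunction over clauses of the disjunction of their
variables. -/
def cnfTrue (φ : MonotoneForm V) (ν : V → Bool) : Prop :=
  ∀ D ∈ φ.clauses, ∃ v ∈ D, ν v = true

/-- The hypergraph whose vertices are the variables and whose edges are the clauses. -/
def hypergraph (φ : MonotoneForm V) : FinHypergraph V where
  edges := φ.clauses
  edge_nonempty := by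
    intro D hD
    obtain ⟨D', hD', hne⟩ := φ.exists_nonempty
    rcases D.eq_empty_or_nonempty with h | h
    · have := φ.minimized D hD D' hD' (by simp [h])
      rw [this]
      exact hne
    · exact h
  edges_nonempty := by
    obtain ⟨D, hD, -⟩ := φ.exists_nonempty
    exact ⟨D, hD⟩

end MonotoneForm

/-! ### Boolean circuits -/

/-- Gate types; a variable gate carries the variable with which it is identified. -/
inductive GateKind (V : Type*) where
  | var (v : V) : GateKind V
  | not : GateKind V
  | or : GateKind V
  | and : GateKind V

/-- A Boolean circuit with set of gates `G`, whose variable gates are in bijection with `V`.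
`wire h g` means that `h` is an input of `g`. The fan-in of AND- and OR-gates is arbitrary. -/
structure BoolCircuit (V : Type*) (G : Type*) where
  wire : G → G → Prop
  acyclic : ∀ g, ¬ Relation.TransGen wire g g
  output : G
  kind : G → GateKind V
  var_bijective : ∀ v : V, ∃! g, kind g = GateKind.var v
  var_fanIn : ∀ g v, kind g = GateKind.var v → ∀ h, ¬ wire h g
  not_fanIn : ∀ g, kind g = GateKind.not → ∃! h, wire h g

/-- V-tree skeletons: rooted ordered binary trees (an internal node has one or two children)
with leaves labeled by variables. -/
inductive VTree (V : Type*) where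
  | leaf (v : V) : VTree V
  | unary (t : VTree V) : VTree V
  | node (l r : VTree V) : VTree V

namespace VTree

variable {V : Type*}

/-- The labels of the leaves, from left to right. -/
def leaves : VTree V → List V
  | leaf v => [v]
  | unary t => t.leaves
  | node l r => l.leaves ++ r.leaves

/-- The list of subtrees rooted at the children of the root. -/
def children : VTree V → List (VTree V)
  | leaf _ => []
  | unary t => [t]
  | node l r => [l, r]

/-- `T` is a v-tree over the whole set `V`: its leaves are in bijection with `V`. -/
def IsOver (T : VTree V) : Prop :=
  T.leaves.Nodup ∧ ∀ v : V, v ∈ T.leaves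

/-- `IsSubtree s T`: `s` is the subtree of `T` rooted at one of the nodes of `T`. -/
inductive IsSubtree : VTree V → VTree V → Prop
  | refl (T : VTree V) : IsSubtree T T
  | child {s t T : VTree V} (ht : t ∈ T.children) (hs : IsSubtree s t) : IsSubtree s T

end VTree

namespace BoolCircuit

variable {V G : Type*}

theorem wellFounded_wire [Finite G] (C : BoolCircuit V G) : WellFounded C.wire := by
  have : Std.Irrefl (Relation.TransGen C.wire) := ⟨C.acyclic⟩
  exact Subrelation.wf (fun h => Relation.TransGen.single h)
    (Finite.wellFounded_of_trans_of_irrefl (Relation.TransGen C.wire))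

/-- The truth value of a gate, given the truth values of its inputs. -/
def evalStep (C : BoolCircuit V G) (ν : V → Bool) (g : G)
    (rec : ∀ h, C.wire h g → Prop) : Prop :=
  match C.kind g with
  | GateKind.var v => ν v = true
  | GateKind.not => ∃ h, ∃ w : C.wire h g, ¬ rec h w
  | GateKind.or => ∃ h, ∃ w : C.wire h g, rec h w
  | GateKind.and => ∀ h, ∀ w : C.wire h g, rec h w

/-- `C.GateTrue ν g`: the gate `g` evaluates to 1 under the valuation `ν`. -/
def GateTrue [Finite G] (C : BoolCircuit V G) (ν : V → Bool) : G → Prop :=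
  C.wellFounded_wire.fix (C.evalStep ν)

theorem gateTrue_iff [Finite G] (C : BoolCircuit V G) (ν : V → Bool) (g : G) :
    C.GateTrue ν g ↔
      match C.kind g with
      | GateKind.var v => ν v = true
      | GateKind.not => ∃ h, C.wire h g ∧ ¬ C.GateTrue ν h
      | GateKind.or => ∃ h, C.wire h g ∧ C.GateTrue ν h
      | GateKind.and => ∀ h, C.wire h g → C.GateTrue ν h := by
  unfold GateTrue
  rw [WellFounded.fix_eq]
  generalize C.wellFounded_wire.fix (C.evalStep ν) = F
  unfold evalStep
  cases C.kind g <;> simp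

/-- The circuit captures the Boolean function `f`. -/
def Captures [Finite G] (C : BoolCircuit V G) (f : (V → Bool) → Prop) : Prop :=
  ∀ ν, C.GateTrue ν C.output ↔ f ν

/-- The number of gates. -/
def size [Fintype G] (_C : BoolCircuit V G) : ℕ :=
  Fintype.card G

/-- The variables whose gate has a directed path (possibly of length 0) to `g`. -/
def vars (C : BoolCircuit V G) (g : G) : Set V :=
  {v | ∃ h, C.kind h = GateKind.var v ∧ Relation.ReflTransGen C.wire h g}

/-- Negation normal form: the inputs of NOT-gates are variable gates. -/
def IsNNF (C : BoolCircuit V G) : Prop :=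
  ∀ g h, C.kind g = GateKind.not → C.wire h g → ∃ v, C.kind h = GateKind.var v

/-- Every AND-gate has inputs that depend on pairwise disjoint sets of variables. -/
def IsDecomposable (C : BoolCircuit V G) : Prop :=
  ∀ g, C.kind g = GateKind.and → ∀ g₁ g₂, C.wire g₁ g → C.wire g₂ g → g₁ ≠ g₂ →
    Disjoint (C.vars g₁) (C.vars g₂)

/-- The root of the tree `n` structures the gate `g`: for some enumeration `g₁, …, g_m` of the
inputs of `g`, the root has exactly `m` children `n₁, …, n_m`, and the variables of `gᵢ` all label
leaves of the subtree rooted at `nᵢ`. -/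
def StructuresGate (C : BoolCircuit V G) (n : VTree V) (g : G) : Prop :=
  ∃ inputs : List G, inputs.Nodup ∧ (∀ h, h ∈ inputs ↔ C.wire h g) ∧
    List.Forall₂ (fun h c => ∀ v ∈ C.vars h, v ∈ VTree.leaves c) inputs n.children

/-- The circuit is structured by some v-tree over its set of variables. -/
def IsStructured (C : BoolCircuit V G) : Prop :=
  ∃ T : VTree V, T.IsOver ∧
    ∀ g, C.kind g = GateKind.and → (∃ h, C.wire h g) →
      ∃ n, VTree.IsSubtree n T ∧ C.StructuresGate n g

/-- No OR-gate has two distinct inputs that evaluate to 1 under a common valuation. -/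
def IsDeterministic [Finite G] (C : BoolCircuit V G) : Prop :=
  ∀ g, C.kind g = GateKind.or → ∀ g₁ g₂, C.wire g₁ g → C.wire g₂ g → g₁ ≠ g₂ →
    ∀ ν, ¬ (C.GateTrue ν g₁ ∧ C.GateTrue ν g₂)

/-- Structured decomposable circuits in negation normal form. -/
def IsSDNNF (C : BoolCircuit V G) : Prop :=
  C.IsNNF ∧ C.IsDecomposable ∧ C.IsStructured

/-- Deterministic structured decomposable circuits in negation normal form. -/
def IsDSDNNF [Finite G] (C : BoolCircuit V G) : Prop :=
  C.IsSDNNF ∧ C.IsDeterministic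

end BoolCircuit

/-!
Let `T` be a v-tree structuring the circuit, let `n` be a node of `T` and let `X` be the set of
variables labeling the leaves below `n`.

The circuit yields few rectangles. An AND-gate is structured by a node of `T` which either is below
`n`, so that the gate only depends on `X`, or has at most one child whose leaves meet `X`
(`BoolCircuit.cutsAlong_leaves`). By induction on the gates, the captured function is thus a union
of rectangles for the partition `(X, Xᶜ)`, one for each gate, and this union is disjoint if the
circuit is deterministic (`BoolCircuit.exists_rectangles`).

The formula requires many rectangles. Suppose that `k` clauses have variables both in `X` and
outside of `X`, and that no clause meets two of them. Giving the other variables a neutral value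
turns a DNF into the intersection relation `S ∩ T ≠ ∅` of the subsets of these clauses, and a CNF
into the relation `S ∪ T = univ`. The intersection matrix differs from the disjointness matrix,
which is invertible, by a matrix of rank one, so that a disjoint union needs `2 ^ k - 1` rectangles
(`two_pow_card_le_of_disjoint_rectangles`); for the second relation a fooling set shows that any
union needs `2 ^ k` of them (`two_pow_card_le_of_rectangles`).

A suitable node exists. If every node of `T` splits at most `w` clauses, then `T` carries a tree
decomposition of width at most `3 * arity * w` (`FinHypergraph.treewidth_le_of_splitEdges`). Hence
some node splits at least `tw / (3 * arity)` clauses, and among those a maximal family in which no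
two members meet a common clause retains a fraction `1 / (arity * degree) ^ 2`
(`FinHypergraph.exists_unlinked`).
-/

/-! ### Rectangles from circuits -/

namespace BoolCircuit

variable {V G : Type*}

theorem vars_mono {C : BoolCircuit V G} {h g : G} (hw : C.wire h g) : C.vars h ⊆ C.vars g :=
  fun _ ⟨k, hk, hp⟩ => ⟨k, hk, hp.tail hw⟩

theorem mem_vars_iff {C : BoolCircuit V G} {g : G} {v : V} :
    v ∈ C.vars g ↔ C.kind g = GateKind.var v ∨ ∃ h, C.wire h g ∧ v ∈ C.vars h := by
  constructor
  · rintro ⟨k, hk, hp⟩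
    rcases Relation.ReflTransGen.cases_tail hp with rfl | ⟨h, hkh, hw⟩
    · exact Or.inl hk
    · exact Or.inr ⟨h, hw, k, hk, hkh⟩
  · rintro (h | ⟨h, hw, hv⟩)
    · exact ⟨g, h, .refl⟩
    · exact vars_mono hw hv

theorem vars_of_kind_var {C : BoolCircuit V G} {g : G} {v : V}
    (hg : C.kind g = GateKind.var v) : C.vars g = {v} := by
  ext w
  rw [mem_vars_iff, hg]
  constructor
  · rintro (h | ⟨h, hw, -⟩)
    · cases h; rfl
    · exact absurd hw (C.var_fanIn g v hg h)
  · rintro rfl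
    exact Or.inl rfl

theorem vars_of_kind_not {C : BoolCircuit V G} (hC : C.IsNNF) {g : G}
    (hg : C.kind g = GateKind.not) : ∃ v, C.vars g = {v} := by
  obtain ⟨h, hw, huniq⟩ := C.not_fanIn g hg
  obtain ⟨v, hv⟩ := hC g h hg hw
  refine ⟨v, ?_⟩
  ext w
  rw [mem_vars_iff, hg, ← vars_of_kind_var hv]
  constructor
  · rintro (h' | ⟨h', hw', hv'⟩)
    · cases h'
    · rwa [huniq h' hw'] at hv'
  · exact fun hv' => Or.inr ⟨h, hw, hv'⟩

variable [Finite G]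

/-- The value of a gate depends only on the variables below it. -/
theorem gateTrue_congr (C : BoolCircuit V G) {ν ν' : V → Bool} (g : G)
    (hν : ∀ v ∈ C.vars g, ν v = ν' v) : C.GateTrue ν g ↔ C.GateTrue ν' g := by
  induction g using C.wellFounded_wire.induction with
  | _ g ih =>
    have ih' : ∀ h, C.wire h g → (C.GateTrue ν h ↔ C.GateTrue ν' h) := fun h hw =>
      ih h hw fun v hv => hν v (vars_mono hw hv)
    rw [gateTrue_iff C ν, gateTrue_iff C ν']
    cases hk : C.kind g with
    | var v => simp only; rw [hν v (mem_vars_iff.2 (Or.inl hk))]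
    | not => exact exists_congr fun h => and_congr_right fun hw => not_congr (ih' h hw)
    | or => exact exists_congr fun h => and_congr_right fun hw => ih' h hw
    | and => exact forall_congr' fun h => imp_congr_right fun hw => ih' h hw

/-- The circuit can be cut along `X`: every AND-gate that is not entirely on the side of `X` has
at most one input whose variables meet `X`. -/
def CutsAlong (C : BoolCircuit V G) (X : Set V) : Prop :=
  ∀ g, C.kind g = GateKind.and → (∃ h, C.wire h g) → C.vars g ⊆ X ∨
    ∃ h, C.wire h g ∧ ∀ h', C.wire h' g → h' ≠ h → Disjoint (C.vars h') X

/-- The factor on the side of `X` of the rectangle indexed by the gate `u`: the function of `u` if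
`u` only depends on `X`, and otherwise the constant true. -/
def leftFactor (C : BoolCircuit V G) (X : Set V) (u : G) (ν : V → Bool) : Prop :=
  C.vars u ⊆ X → C.GateTrue ν u

/-- By induction on the gates, every gate function is a union of rectangles for the partition
`(X, Xᶜ)`, one for each gate. Gates on the side of `X` are their own rectangle, gates on the side
of `Xᶜ` use the slot of `g₀`, OR-gates take unions slot by slot, and an AND-gate multiplies the
rectangles of a single input by functions of `Xᶜ`. Determinism makes the union disjoint. -/
theorem exists_rectangles_gate (C : BoolCircuit V G) (hC : C.IsNNF) {X : Set V}
    (hX : C.CutsAlong X) {g₀ : G} (hg₀ : ¬ C.vars g₀ ⊆ X) (g : G) :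
    ∃ B : G → (V → Bool) → Prop,
      (∀ u ν ν', (∀ v ∉ X, ν v = ν' v) → (B u ν ↔ B u ν')) ∧
      (∀ ν, C.GateTrue ν g ↔ ∃ u, C.leftFactor X u ν ∧ B u ν) ∧
      (C.IsDeterministic → ∀ ν u u', C.leftFactor X u ν → B u ν → C.leftFactor X u' ν →
        B u' ν → u = u') := by
  induction g using C.wellFounded_wire.induction with
  | _ g ih =>
    by_cases hin : C.vars g ⊆ X
    · refine ⟨fun u _ => u = g, fun _ _ _ _ => Iff.rfl, fun ν => ?_, fun _ _ _ _ _ h _ h' =>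
        h.trans h'.symm⟩
      exact ⟨fun h => ⟨g, fun _ => h, rfl⟩, by rintro ⟨_, h, rfl⟩; exact h hin⟩
    by_cases hout : Disjoint (C.vars g) X
    · refine ⟨fun u ν => u = g₀ ∧ C.GateTrue ν g, fun u ν ν' hν => and_congr_right fun _ =>
        C.gateTrue_congr g fun v hv => hν v (Set.disjoint_left.1 hout hv), fun ν => ?_,
        fun _ _ _ _ _ h _ h' => h.1.trans h'.1.symm⟩
      exact ⟨fun h => ⟨g₀, fun h' => absurd h' hg₀, rfl, h⟩, fun ⟨_, _, _, h⟩ => h⟩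
    have hsing : ∀ v, C.vars g ≠ {v} := by
      intro v hv
      rw [hv] at hin hout
      simp_all
    choose! B hB₁ hB₂ hB₃ using ih
    cases hk : C.kind g with
    | var v => exact absurd (vars_of_kind_var hk) (hsing v)
    | not => obtain ⟨v, hv⟩ := vars_of_kind_not hC hk; exact absurd hv (hsing v)
    | or =>
      refine ⟨fun u ν => ∃ h, C.wire h g ∧ B h u ν, fun u ν ν' hν => exists_congr fun h =>
        and_congr_right fun hw => hB₁ h hw u ν ν' hν, fun ν => ?_, ?_⟩
      · rw [gateTrue_iff, hk]
        constructor
        · rintro ⟨h, hw, ht⟩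
          obtain ⟨u, hu, hb⟩ := (hB₂ h hw ν).1 ht
          exact ⟨u, hu, h, hw, hb⟩
        · rintro ⟨u, hu, h, hw, hb⟩
          exact ⟨h, hw, (hB₂ h hw ν).2 ⟨u, hu, hb⟩⟩
      · rintro hdet ν u u' hu ⟨h, hw, hb⟩ hu' ⟨h', hw', hb'⟩
        have : h = h' := by
          by_contra hne
          exact hdet g hk h h' hw hw' hne ν
            ⟨(hB₂ h hw ν).2 ⟨u, hu, hb⟩, (hB₂ h' hw' ν).2 ⟨u', hu', hb'⟩⟩
        subst this
        exact hB₃ h hw hdet ν u u' hu hb hu' hb'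
    | and =>
      have hne : ∃ h, C.wire h g := by
        obtain ⟨v, hv, -⟩ := Set.not_subset.1 hin
        rcases mem_vars_iff.1 hv with h | ⟨h, hw, -⟩
        · rw [hk] at h; cases h
        · exact ⟨h, hw⟩
      obtain h | ⟨h, hw, hother⟩ := hX g hk hne
      · exact absurd h hin
      refine ⟨fun u ν => B h u ν ∧ ∀ h', C.wire h' g → h' ≠ h → C.GateTrue ν h', ?_, ?_, ?_⟩
      · refine fun u ν ν' hν => and_congr (hB₁ h hw u ν ν' hν) <| forall_congr' fun h' =>
          imp_congr_right fun hw' => imp_congr_right fun hne' => ?_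
        exact C.gateTrue_congr h' fun v hv =>
          hν v (Set.disjoint_left.1 (hother h' hw' hne') hv)
      · intro ν
        rw [gateTrue_iff, hk]
        constructor
        · intro hall
          obtain ⟨u, hu, hb⟩ := (hB₂ h hw ν).1 (hall h hw)
          exact ⟨u, hu, hb, fun h' hw' _ => hall h' hw'⟩
        · rintro ⟨u, hu, hb, hall⟩ h' hw'
          by_cases hh : h' = h
          · subst hh; exact (hB₂ h' hw' ν).2 ⟨u, hu, hb⟩
          · exact hall h' hw' hh
      · rintro hdet ν u u' hu ⟨hb, -⟩ hu' ⟨hb', -⟩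
        exact hB₃ h hw hdet ν u u' hu hb hu' hb'

/-- A circuit that can be cut along `X`, with at least one variable outside of `X`, captures a
union of `size`-many rectangles, which are disjoint if the circuit is deterministic. -/
theorem exists_rectangles (C : BoolCircuit V G) (hC : C.IsNNF) {X : Set V}
    (hX : C.CutsAlong X) {y : V} (hy : y ∉ X) {f : (V → Bool) → Prop} (hf : C.Captures f) :
    ∃ A B : G → (V → Bool) → Prop,
      (∀ u ν ν', (∀ v ∈ X, ν v = ν' v) → (A u ν ↔ A u ν')) ∧
      (∀ u ν ν', (∀ v ∉ X, ν v = ν' v) → (B u ν ↔ B u ν')) ∧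
      (∀ ν, f ν ↔ ∃ u, A u ν ∧ B u ν) ∧
      (C.IsDeterministic → ∀ ν u u', A u ν → B u ν → A u' ν → B u' ν → u = u') := by
  obtain ⟨g₀, hg₀, -⟩ := C.var_bijective y
  obtain ⟨B, hB₁, hB₂, hB₃⟩ := C.exists_rectangles_gate hC hX (g₀ := g₀)
    (by rw [vars_of_kind_var hg₀]; simpa using hy) C.output
  refine ⟨C.leftFactor X, B, fun u ν ν' hν => ?_, hB₁, fun ν => (hf ν).symm.trans (hB₂ ν), hB₃⟩
  exact imp_congr_right fun hu => C.gateTrue_congr u fun v hv => hν v (hu hv)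

end BoolCircuit

/-! ### Lower bounds on the number of rectangles -/

/-- The intersection matrix `[S ∩ T ≠ ∅]` of the subsets of `ι` is not a disjoint union of fewer
than `2 ^ |ι| - 1` rectangles: a vector orthogonal to the all-one function and to the row
indicators of the rectangles is in the kernel of the disjointness matrix, which is
unitriangular after complementing `T`. -/
theorem two_pow_card_le_of_disjoint_rectangles {ι G : Type*} [Fintype ι] [Fintype G]
    (a b : G → Set ι → Prop)
    (hab : ∀ S T : Set ι, (S ∩ T).Nonempty ↔ ∃ u, a u S ∧ b u T)
    (huniq : ∀ S T u u', a u S → b u T → a u' S → b u' T → u = u') :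
    2 ^ Fintype.card ι ≤ Fintype.card G + 1 := by
  classical
  by_contra! hlt
  let M : (Set ι → ℚ) →ₗ[ℚ] (Option G → ℚ) :=
    Matrix.mulVecLin (Matrix.of fun u S => u.elim 1 fun u => if a u S then 1 else 0)
  have hker : LinearMap.ker M ≠ ⊥ := LinearMap.ker_ne_bot_of_finrank_lt (by simpa using hlt)
  obtain ⟨c, hc, hc0⟩ := (Submodule.ne_bot_iff _).1 hker
  have hrow : ∀ u, ∑ S, (if a u S then 1 else 0) * c S = 0 := fun u => congrFun hc (some u)
  have hone : ∑ S, c S = 0 := by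
    have h := congrFun hc none
    simpa [M, Matrix.mulVec, dotProduct] using h
  have hdisj : ∀ T : Set ι, ∑ S, (if (S ∩ T).Nonempty then 0 else 1) * c S = 0 := by
    intro T
    have hentry : ∀ S : Set ι, (if (S ∩ T).Nonempty then (0 : ℚ) else 1) =
        1 - ∑ u, (if a u S then 1 else 0) * (if b u T then 1 else 0) := by
      intro S
      split_ifs with h
      · obtain ⟨u, hu, hu'⟩ := (hab S T).1 h
        rw [Finset.sum_eq_single u]
        · simp [hu, hu']
        · intro u' _ hne
          by_cases h1 : a u' S
          · by_cases h2 : b u' T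
            · exact absurd (huniq S T u' u h1 h2 hu hu') hne
            · simp [h2]
          · simp [h1]
        · simp
      · rw [Finset.sum_eq_zero, sub_zero]
        intro u _
        by_cases h1 : a u S
        · by_cases h2 : b u T
          · exact absurd ((hab S T).2 ⟨u, h1, h2⟩) h
          · simp [h2]
        · simp [h1]
    simp_rw [hentry, sub_mul, one_mul, Finset.sum_sub_distrib, hone, Finset.sum_mul]
    rw [Finset.sum_comm, zero_sub, neg_eq_zero]
    refine Finset.sum_eq_zero fun u _ => ?_
    calc _ = (if b u T then 1 else 0) * ∑ S, (if a u S then 1 else 0) * c S := by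
          rw [Finset.mul_sum]
          exact Finset.sum_congr rfl fun S _ => by ring
      _ = 0 := by rw [hrow, mul_zero]
  -- A minimal set in the support of `c` contradicts the disjointness row of its complement.
  obtain ⟨S₀, hS₀⟩ : ∃ S, c S ≠ 0 := by
    by_contra! h
    exact hc0 (funext h)
  obtain ⟨S, -, hS⟩ := (Set.toFinite {S | c S ≠ 0}).exists_le_minimal hS₀
  refine hS.prop ?_
  have := hdisj Sᶜ
  rw [Finset.sum_eq_single S] at this
  · simpa using this
  · intro S' _ hne
    split_ifs with h
    · simp
    · rw [one_mul]
      by_contra hcS'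
      have hsub : S' ⊆ S := by
        rw [Set.not_nonempty_iff_eq_empty, ← Set.disjoint_iff_inter_eq_empty,
          Set.disjoint_compl_right_iff_subset] at h
        exact h
      exact hne (hsub.antisymm (hS.le_of_le hcS' hsub))
  · simp

/-- The complementary pairs `(S, Sᶜ)` are a fooling set for the relation `S ∪ T = univ`. -/
theorem two_pow_card_le_of_rectangles {ι G : Type*} [Fintype ι] [Fintype G]
    (a b : G → Set ι → Prop) (hab : ∀ S T : Set ι, S ∪ T = Set.univ ↔ ∃ u, a u S ∧ b u T) :
    2 ^ Fintype.card ι ≤ Fintype.card G := by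
  classical
  have h : ∀ S : Set ι, ∃ u, a u S ∧ b u Sᶜ := fun S => (hab S Sᶜ).1 (Set.union_compl_self S)
  choose u hu using h
  have hsub : ∀ S S', u S = u S' → S' ⊆ S := by
    intro S S' hS x hx
    have : x ∈ S ∪ S'ᶜ := by
      rw [(hab S S'ᶜ).2 ⟨u S, (hu S).1, hS ▸ (hu S').2⟩]
      trivial
    exact this.resolve_right (fun h => h hx)
  rw [← Fintype.card_set]
  exact Fintype.card_le_of_injective u fun S S' hS =>
    (hsub S' S hS.symm).antisymm (hsub S S' hS)

/-! ### Trees given by parent functions -/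

namespace SimpleGraph

/-- The graph of a parent function. -/
def ofParent {N : Type*} (par : N → N) : SimpleGraph N :=
  fromRel fun n m => par n = m

theorem ofParent_adj {N : Type*} {par : N → N} {n : N} (h : n ≠ par n) :
    (ofParent par).Adj n (par n) :=
  (fromRel_adj _ _ _).2 ⟨h, Or.inl rfl⟩

/-- The graph of a parent function is a tree when the parent of every node but the root has a
larger height: it is connected through the root, and has one edge for every other node. -/
theorem isTree_ofParent {N : Type*} [Finite N] (par : N → N) (height : N → ℕ) (r : N)
    (hr : par r = r) (hpar : ∀ n, n ≠ r → height n < height (par n)) :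
    (ofParent par).IsTree := by
  classical
  have := Fintype.ofFinite N
  have hself : ∀ n, n ≠ r → n ≠ par n := fun n hn h => by
    have := hpar n hn
    rw [← h] at this
    exact lt_irrefl _ this
  obtain ⟨M, hM⟩ := (Set.finite_range height).bddAbove
  have hreach : ∀ k n, M - height n ≤ k → (ofParent par).Reachable n r := by
    intro k
    induction k with
    | zero =>
      intro n hn
      by_cases h : n = r
      · rw [h]
      · have h1 := hpar n h
        have h2 : height (par n) ≤ M := hM ⟨_, rfl⟩
        omega
    | succ k ih =>
      intro n hn
      by_cases h : n = r
      · rw [h]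
      · have h1 := hpar n h
        have h2 : height (par n) ≤ M := hM ⟨_, rfl⟩
        exact (ofParent_adj (hself n h)).reachable.trans (ih (par n) (by omega))
  rw [isTree_iff_connected_and_card]
  have : Nonempty N := ⟨r⟩
  refine ⟨⟨fun n m => (hreach _ n le_rfl).trans (hreach _ m le_rfl).symm⟩, ?_⟩
  have hedges : (ofParent par).edgeSet = (fun n => s(n, par n)) '' {n | n ≠ r} := by
    ext e
    induction e with
    | _ n m =>
      simp only [mem_edgeSet, ofParent, fromRel_adj, Set.mem_image, Set.mem_ofPred_eq]
      constructor
      · rintro ⟨hne, h | h⟩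
        · refine ⟨n, ?_, by rw [h]⟩
          rintro rfl
          exact hne (hr.symm.trans h)
        · refine ⟨m, ?_, by rw [h, Sym2.eq_swap]⟩
          rintro rfl
          exact hne (h.symm.trans hr)
      · rintro ⟨x, hx, h⟩
        rcases Sym2.eq_iff.1 h with ⟨rfl, rfl⟩ | ⟨rfl, rfl⟩
        · exact ⟨hself _ hx, Or.inl rfl⟩
        · exact ⟨(hself _ hx).symm, Or.inr rfl⟩
  have hinj : Set.InjOn (fun n => s(n, par n)) {n | n ≠ r} := by
    intro n hn m hm h
    rcases Sym2.eq_iff.1 h with ⟨h, -⟩ | ⟨h1, h2⟩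
    · exact h
    · have h3 := hpar n hn
      have h4 := hpar m hm
      rw [h2] at h3
      rw [← h1] at h4
      exact absurd h3 h4.asymm
  rw [Nat.card_coe_set_eq, hedges, hinj.ncard_image]
  have : ({n | n ≠ r} : Set N) = {r}ᶜ := rfl
  rw [this, Set.ncard_compl, Set.ncard_singleton]
  have : 0 < Nat.card N := Nat.card_pos_iff.2 ⟨⟨r⟩, inferInstance⟩
  omega

end SimpleGraph

/-! ### Subtrees of v-trees -/

namespace VTree

variable {V : Type*}

theorem IsSubtree.trans {s t u : VTree V} (h₁ : IsSubtree s t) (h₂ : IsSubtree t u) :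
    IsSubtree s u := by
  induction h₂ with
  | refl => exact h₁
  | child ht _ ih => exact .child ht ih

theorem isSubtree_of_mem_children {s t : VTree V} (h : s ∈ t.children) : IsSubtree s t :=
  .child h (.refl s)

theorem sizeOf_lt_of_mem_children {s t : VTree V} (h : s ∈ t.children) : sizeOf s < sizeOf t := by
  cases t with
  | leaf v => simp [children] at h
  | unary t => simp only [children, List.mem_singleton] at h; subst h; simp
  | node l r =>
    simp only [children, List.mem_cons, List.not_mem_nil, or_false] at h
    rcases h with rfl | rfl
    · simp; omega
    · simp

theorem IsSubtree.sizeOf_le {s t : VTree V} (h : IsSubtree s t) : sizeOf s ≤ sizeOf t := by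
  induction h with
  | refl => exact le_rfl
  | child ht _ ih => exact ih.trans (sizeOf_lt_of_mem_children ht).le

theorem IsSubtree.eq_or_exists_parent {s t : VTree V} (h : IsSubtree s t) :
    s = t ∨ ∃ p, IsSubtree p t ∧ s ∈ p.children := by
  induction h with
  | refl => exact Or.inl rfl
  | child ht _ ih =>
    rcases ih with rfl | ⟨p, hp, hs⟩
    · exact Or.inr ⟨_, .refl _, ht⟩
    · exact Or.inr ⟨p, .child ht hp, hs⟩

theorem finite_isSubtree (t : VTree V) : {s | IsSubtree s t}.Finite := by
  have key : ∀ t : VTree V, (∀ c ∈ t.children, {s | IsSubtree s c}.Finite) →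
      {s | IsSubtree s t}.Finite := by
    intro t h
    refine ((t.children.finite_toSet.biUnion h).union (Set.finite_singleton t)).subset ?_
    intro s hs
    cases hs with
    | refl => exact Or.inr rfl
    | child hc hs => exact Or.inl (Set.mem_biUnion hc hs)
  induction t with
  | leaf v => exact key _ (by simp [children])
  | unary t ih => exact key _ (by simpa [children] using ih)
  | node l r ihl ihr => exact key _ (by simpa [children] using ⟨ihl, ihr⟩)

theorem mem_leaves_of_mem_children {c t : VTree V} (h : c ∈ t.children) {v : V}
    (hv : v ∈ c.leaves) : v ∈ t.leaves := by
  cases t with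
  | leaf v => simp [children] at h
  | unary t => simp only [children, List.mem_singleton] at h; subst h; exact hv
  | node l r =>
    simp only [children, List.mem_cons, List.not_mem_nil, or_false] at h
    rcases h with rfl | rfl <;> simp [leaves, hv]

theorem IsSubtree.mem_leaves {s t : VTree V} (h : IsSubtree s t) {v : V} (hv : v ∈ s.leaves) :
    v ∈ t.leaves := by
  induction h with
  | refl => exact hv
  | child ht _ ih => exact mem_leaves_of_mem_children ht ih

theorem IsSubtree.nodup {s t : VTree V} (h : IsSubtree s t) (ht : t.leaves.Nodup) :
    s.leaves.Nodup := by
  induction h with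
  | refl => exact ht
  | @child u t hu _ ih =>
    refine ih ?_
    cases t with
    | leaf v => simp [children] at hu
    | unary t => simp only [children, List.mem_singleton] at hu; subst hu; exact ht
    | node l r =>
      simp only [children, List.mem_cons, List.not_mem_nil, or_false] at hu
      rcases hu with rfl | rfl
      · exact (List.nodup_append.1 ht).1
      · exact (List.nodup_append.1 ht).2.1

theorem eq_of_mem_children {t c c' : VTree V} (ht : t.leaves.Nodup) (hc : c ∈ t.children)
    (hc' : c' ∈ t.children) {v : V} (hv : v ∈ c.leaves) (hv' : v ∈ c'.leaves) : c = c' := by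
  cases t with
  | leaf v => simp [children] at hc
  | unary t => simp only [children, List.mem_singleton] at hc hc'; rw [hc, hc']
  | node l r =>
    have hd := (List.nodup_append.1 ht).2.2
    simp only [children, List.mem_cons, List.not_mem_nil, or_false] at hc hc'
    rcases hc with rfl | rfl <;> rcases hc' with rfl | rfl
    · rfl
    · exact absurd rfl (hd v hv v hv')
    · exact absurd rfl (hd v hv' v hv)
    · rfl

/-- The leaf sets of the subtrees form a laminar family. -/
theorem IsSubtree.total {s s' t : VTree V} (ht : t.leaves.Nodup) (hs : IsSubtree s t)
    (hs' : IsSubtree s' t) {v : V} (hv : v ∈ s.leaves) (hv' : v ∈ s'.leaves) :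
    IsSubtree s s' ∨ IsSubtree s' s := by
  induction hs with
  | refl => exact Or.inr hs'
  | @child c t hc hsc ih =>
    cases hs' with
    | refl => exact Or.inl (.child hc hsc)
    | @child c' _ hc' hs'c =>
      have := eq_of_mem_children ht hc hc' (hsc.mem_leaves hv) (hs'c.mem_leaves hv')
      subst this
      exact ih ((isSubtree_of_mem_children hc).nodup ht) hs'c

theorem isSubtree_leaf {t : VTree V} {v : V} (hv : v ∈ t.leaves) : IsSubtree (leaf v) t := by
  induction t with
  | leaf w => simp only [leaves, List.mem_singleton] at hv; subst hv; exact .refl _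
  | unary t ih => exact .child (by simp [children]) (ih hv)
  | node l r ihl ihr =>
    rcases List.mem_append.1 hv with h | h
    · exact .child (by simp [children]) (ihl h)
    · exact .child (by simp [children]) (ihr h)

/-- The set `e` has elements both among the leaves of `t` and outside of them. -/
def Splits (t : VTree V) (e : Finset V) : Prop :=
  (∃ x ∈ e, x ∈ t.leaves) ∧ ∃ y ∈ e, y ∉ t.leaves

/-- The lowest node of the v-tree that contains `e` does not depend on the node split by `e` from
which it is reached. -/
theorem parent_eq_of_splits {T s s' p p' : VTree V} (hT : T.leaves.Nodup) {e : Finset V}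
    (hp : IsSubtree p T) (hp' : IsSubtree p' T) (hs : s ∈ p.children) (hs' : s' ∈ p'.children)
    (hse : s.Splits e) (hse' : s'.Splits e) (he : ∀ x ∈ e, x ∈ p.leaves)
    (he' : ∀ x ∈ e, x ∈ p'.leaves) : p = p' := by
  -- If `q` lay strictly below `q'`, then `e` would be contained in a child of `q'`.
  have key : ∀ q q' c' : VTree V, IsSubtree q' T → c' ∈ q'.children → c'.Splits e →
      (∀ x ∈ e, x ∈ q.leaves) → IsSubtree q q' → q = q' := by
    intro q q' c' hq' hc' hce hqe hqq
    cases hqq with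
    | refl => rfl
    | @child c _ hc hqc =>
      obtain ⟨⟨x, hxe, hx⟩, y, hye, hy⟩ := hce
      have : c = c' :=
        eq_of_mem_children (hq'.nodup hT) hc hc' (hqc.mem_leaves (hqe x hxe)) hx
      subst this
      exact absurd (hqc.mem_leaves (hqe y hye)) hy
  obtain ⟨x, hxe, -⟩ := hse.1
  rcases hp.total hT hp' (he x hxe) (he' x hxe) with h | h
  · exact key p p' s' hp' hs' hse' he h
  · exact (key p' p s hp hs hse he' h).symm

end VTree

/-! ### Tree decompositions from v-trees -/

namespace FinHypergraph

variable {V : Type*}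

open Classical in
/-- The edges with vertices both among the leaves of `t` and outside of them. -/
noncomputable def splitEdges (H : FinHypergraph V) (t : VTree V) : Finset (Finset V) :=
  H.edges.filter t.Splits

theorem mem_splitEdges {H : FinHypergraph V} {t : VTree V} {e : Finset V} :
    e ∈ H.splitEdges t ↔ e ∈ H.edges ∧ t.Splits e := by
  classical exact Finset.mem_filter

theorem card_le_arity {H : FinHypergraph V} {e : Finset V} (he : e ∈ H.edges) :
    e.card ≤ H.arity :=
  Finset.le_sup (f := Finset.card) he

/-- A v-tree on which every node splits at most `w` edges yields a tree decomposition: the bag of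
a node is the union of the edges split by the node or by one of its children, to which the vertex
labeling the node is added if the node is a leaf. The nodes whose bag contains a given edge `e`
because of `e` itself are those between the leaves of `e` and their lowest common ancestor. -/
theorem treewidth_le_of_splitEdges [Fintype V] (H : FinHypergraph V) {T : VTree V}
    (hT : T.IsOver) {w : ℕ}
    (hw : ∀ t, VTree.IsSubtree t T → (H.splitEdges t).card ≤ w) :
    H.treewidth ≤ 3 * H.arity * w := by
  classical
  let N := {s : VTree V // VTree.IsSubtree s T}
  have : Finite N := T.finite_isSubtree
  obtain ⟨n, ⟨φ⟩⟩ := Finite.exists_equiv_fin N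
  let tr : Fin n → VTree V := fun i => (φ.symm i).1
  have htr : ∀ i, VTree.IsSubtree (tr i) T := fun i => (φ.symm i).2
  have htr_inj : Function.Injective tr := Subtype.val_injective.comp φ.symm.injective
  have htr_surj : ∀ s, VTree.IsSubtree s T → ∃ i, tr i = s := fun s hs =>
    ⟨φ ⟨s, hs⟩, by simp [tr]⟩
  obtain ⟨r, hr⟩ := htr_surj T (.refl T)
  -- The root is its own parent.
  have hpar_ex : ∀ i, ∃ p, (i = r → p = r) ∧ (i ≠ r → tr i ∈ (tr p).children) := by
    intro i
    by_cases h : i = r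
    · exact ⟨r, fun _ => rfl, fun h' => absurd h h'⟩
    · rcases (htr i).eq_or_exists_parent with h' | ⟨p, hp, hip⟩
      · exact absurd (htr_inj (h'.trans hr.symm)) h
      · obtain ⟨j, rfl⟩ := htr_surj p hp
        exact ⟨j, fun h' => absurd h' h, fun _ => hip⟩
  choose par hpar_root hpar using hpar_ex
  have hne : ∀ i, i ≠ r → i ≠ par i := fun i hi h => by
    have := VTree.sizeOf_lt_of_mem_children (hpar i hi)
    rw [← h] at this
    exact lt_irrefl _ this
  have hsplit_root : ∀ i e, (tr i).Splits e → i ≠ r := by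
    rintro i e ⟨-, y, -, hy⟩ rfl
    rw [hr] at hy
    exact hy (hT.2 y)
  let bag : Fin n → Finset V := fun i => Finset.univ.filter fun v => tr i = VTree.leaf v ∨
    ∃ e ∈ H.edges, v ∈ e ∧ ((tr i).Splits e ∨ ∃ c, par c = i ∧ c ≠ r ∧ (tr c).Splits e)
  have hbag : ∀ i v, v ∈ bag i ↔ tr i = VTree.leaf v ∨ ∃ e ∈ H.edges, v ∈ e ∧
      ((tr i).Splits e ∨ ∃ c, par c = i ∧ c ≠ r ∧ (tr c).Splits e) := by
    intro i v
    simp [bag]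
  have hleaf_splits : ∀ (v : V) (e : Finset V), v ∈ e → e ≠ {v} → (VTree.leaf v).Splits e := by
    intro v e hv hne'
    refine ⟨⟨v, hv, by simp [VTree.leaves]⟩, ?_⟩
    by_contra! h
    exact hne' (Finset.eq_singleton_iff_unique_mem.2 ⟨hv, fun x hx => by
      simpa [VTree.leaves] using h x hx⟩)
  let D : H.TreeDecomposition :=
    { numNodes := n
      tree := SimpleGraph.ofParent par
      isTree := SimpleGraph.isTree_ofParent par (fun i => sizeOf (tr i)) r (hpar_root r rfl)
        fun i hi => VTree.sizeOf_lt_of_mem_children (hpar i hi)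
      bag := bag
      edge_subset_bag := by
        intro e he
        obtain ⟨v, hv⟩ := H.edge_nonempty e he
        obtain ⟨i, hi⟩ := htr_surj _ (VTree.isSubtree_leaf (hT.2 v))
        refine ⟨i, fun x hx => (hbag i x).2 ?_⟩
        by_cases h : e = {v}
        · rw [h, Finset.mem_singleton] at hx
          exact Or.inl (hx ▸ hi)
        · exact Or.inr ⟨e, he, hx, Or.inl (hi ▸ hleaf_splits v e hv h)⟩
      connected_bags := by
        intro v
        obtain ⟨ℓ, hℓ⟩ := htr_surj _ (VTree.isSubtree_leaf (hT.2 v))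
        set S : Set (Fin n) := {b | v ∈ bag b}
        have hℓS : ℓ ∈ S := (hbag ℓ v).2 (Or.inl hℓ)
        -- Climbing from a node split by `e` leads to the lowest node that contains `e`.
        have climb : ∀ e ∈ H.edges, v ∈ e → ∀ k i, sizeOf T - sizeOf (tr i) ≤ k →
            (tr i).Splits e → ∃ c, c ≠ r ∧ (tr c).Splits e ∧ (∀ x ∈ e, x ∈ (tr (par c)).leaves) ∧
              ∀ (hi : i ∈ S) (hp : par c ∈ S), ((SimpleGraph.ofParent par).induce S).Reachable
                ⟨i, hi⟩ ⟨par c, hp⟩ := by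
          intro e he hve k
          induction k with
          | zero =>
            intro i hi hsp
            have hir := hsplit_root i e hsp
            have h1 := VTree.sizeOf_lt_of_mem_children (hpar i hir)
            have h2 := (htr (par i)).sizeOf_le
            omega
          | succ k ih =>
            intro i hi hsp
            have hir := hsplit_root i e hsp
            have h1 := VTree.sizeOf_lt_of_mem_children (hpar i hir)
            have hadj := SimpleGraph.ofParent_adj (hne i hir)
            have hpS : par i ∈ S :=
              (hbag _ v).2 (Or.inr ⟨e, he, hve, Or.inr ⟨i, rfl, hir, hsp⟩⟩)
            have hstep : ∀ hi : i ∈ S, ((SimpleGraph.ofParent par).induce S).Reachable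
                ⟨i, hi⟩ ⟨par i, hpS⟩ := fun hi =>
              SimpleGraph.Adj.reachable (by simpa using hadj)
            by_cases hall : ∀ x ∈ e, x ∈ (tr (par i)).leaves
            · exact ⟨i, hir, hsp, hall, fun hi _ => hstep hi⟩
            · push Not at hall
              obtain ⟨x, hx, hxi⟩ := hsp.1
              obtain ⟨c, hc, hcs, hcl, hreach⟩ := ih (par i) (by omega)
                ⟨⟨x, hx, VTree.mem_leaves_of_mem_children (hpar i hir) hxi⟩, hall⟩
              exact ⟨c, hc, hcs, hcl, fun hi hp => (hstep hi).trans (hreach hpS hp)⟩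
        have hsp_reach : ∀ e ∈ H.edges, v ∈ e → ∀ i, (tr i).Splits e → ∀ hi : i ∈ S,
            ((SimpleGraph.ofParent par).induce S).Reachable ⟨i, hi⟩ ⟨ℓ, hℓS⟩ := by
          intro e he hve i hsp hi
          have hev : e ≠ {v} := by
            rintro rfl
            obtain ⟨⟨x, hx, hx'⟩, y, hy, hy'⟩ := hsp
            rw [Finset.mem_singleton] at hx hy
            subst hx hy
            exact hy' hx'
          obtain ⟨c, hc, hcs, hcl, hreach⟩ := climb e he hve _ i le_rfl hsp
          obtain ⟨c', hc', hcs', hcl', hreach'⟩ := climb e he hve _ ℓ le_rfl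
            (hℓ ▸ hleaf_splits v e hve hev)
          have hpp : par c = par c' := htr_inj <| VTree.parent_eq_of_splits hT.1 (htr _) (htr _)
            (hpar c hc) (hpar c' hc') hcs hcs' hcl hcl'
          have hpS : par c ∈ S :=
            (hbag _ v).2 (Or.inr ⟨e, he, hve, Or.inr ⟨c, rfl, hc, hcs⟩⟩)
          have h2 := hreach' hℓS (hpp ▸ hpS)
          simp only [← hpp] at h2
          exact (hreach hi hpS).trans h2.symm
        have hall : ∀ i : S, ((SimpleGraph.ofParent par).induce S).Reachable i ⟨ℓ, hℓS⟩ := by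
          rintro ⟨i, hi⟩
          rcases (hbag i v).1 hi with h | ⟨e, he, hve, h | ⟨c, rfl, hc, h⟩⟩
          · have : i = ℓ := htr_inj (h.trans hℓ.symm)
            subst this
            rfl
          · exact hsp_reach e he hve i h hi
          · have hcS : v ∈ bag c := (hbag c v).2 (Or.inr ⟨e, he, hve, Or.inl h⟩)
            have hadj := SimpleGraph.ofParent_adj (hne c hc)
            have hstep : ((SimpleGraph.ofParent par).induce S).Adj ⟨c, hcS⟩ ⟨par c, hi⟩ := by
              simpa using hadj
            exact hstep.symm.reachable.trans (hsp_reach e he hve c h hcS)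
        exact fun i j => (hall i).trans (hall j).symm }
  have hcover : ∀ t, VTree.IsSubtree t T →
      ((H.splitEdges t).biUnion id).card ≤ H.arity * w := fun t ht =>
    (Finset.card_biUnion_le_card_mul _ _ _ fun e he =>
      card_le_arity (mem_splitEdges.1 he).1).trans (by
        rw [mul_comm]
        exact Nat.mul_le_mul_left _ (hw t ht))
  have hmem_cover : ∀ t e v, e ∈ H.edges → v ∈ e → t.Splits e →
      v ∈ (H.splitEdges t).biUnion id := fun t e v he hv ht =>
    Finset.mem_biUnion.2 ⟨e, mem_splitEdges.2 ⟨he, ht⟩, hv⟩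
  -- The additional `1` accounts for the label of a leaf; the width subtracts it again.
  have hcard : ∀ i, (bag i).card ≤ 3 * H.arity * w + 1 := by
    intro i
    have hi := htr i
    have h0 := hcover _ hi
    cases ht : tr i with
    | leaf v =>
      have : bag i ⊆ insert v ((H.splitEdges (tr i)).biUnion id) := by
        intro x hx
        rcases (hbag i x).1 hx with h | ⟨e, he, hxe, h | ⟨c, rfl, hc, h⟩⟩
        · rw [ht] at h
          cases h
          exact Finset.mem_insert_self _ _
        · exact Finset.mem_insert_of_mem (hmem_cover _ e x he hxe h)
        · have := hpar c hc
          rw [ht] at this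
          simp [VTree.children] at this
      have := (Finset.card_le_card this).trans (Finset.card_insert_le _ _)
      nlinarith [Nat.zero_le (H.arity * w)]
    | unary t =>
      have h1 := hcover t (.trans (.child (by simp [VTree.children]) (.refl t)) (ht ▸ hi))
      have : bag i ⊆ (H.splitEdges (tr i)).biUnion id ∪ (H.splitEdges t).biUnion id := by
        intro x hx
        rw [Finset.mem_union]
        rcases (hbag i x).1 hx with h | ⟨e, he, hxe, h | ⟨c, rfl, hc, h⟩⟩
        · rw [ht] at h
          cases h
        · exact Or.inl (hmem_cover _ e x he hxe h)
        · have := hpar c hc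
          rw [ht] at this
          simp only [VTree.children, List.mem_singleton] at this
          exact Or.inr (hmem_cover _ e x he hxe (this ▸ h))
      have := (Finset.card_le_card this).trans (Finset.card_union_le _ _)
      nlinarith [Nat.zero_le (H.arity * w)]
    | node l r' =>
      have h1 := hcover l (.trans (.child (by simp [VTree.children]) (.refl l)) (ht ▸ hi))
      have h2 := hcover r' (.trans (.child (by simp [VTree.children]) (.refl r')) (ht ▸ hi))
      have : bag i ⊆ (H.splitEdges (tr i)).biUnion id ∪
          ((H.splitEdges l).biUnion id ∪ (H.splitEdges r').biUnion id) := by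
        intro x hx
        rw [Finset.mem_union, Finset.mem_union]
        rcases (hbag i x).1 hx with h | ⟨e, he, hxe, h | ⟨c, rfl, hc, h⟩⟩
        · rw [ht] at h
          cases h
        · exact Or.inl (hmem_cover _ e x he hxe h)
        · have := hpar c hc
          rw [ht] at this
          simp only [VTree.children, List.mem_cons, List.not_mem_nil, or_false] at this
          rcases this with h' | h'
          · exact Or.inr (Or.inl (hmem_cover _ e x he hxe (h' ▸ h)))
          · exact Or.inr (Or.inr (hmem_cover _ e x he hxe (h' ▸ h)))
      have := (Finset.card_le_card this).trans ((Finset.card_union_le _ _).trans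
        (Nat.add_le_add_left (Finset.card_union_le _ _) _))
      nlinarith [Nat.zero_le (H.arity * w)]
  have hD : H.treewidth ≤ D.width := Nat.sInf_le ⟨D, rfl⟩
  refine hD.trans ?_
  have : (Finset.univ.sup fun b => (D.bag b).card) ≤ 3 * H.arity * w + 1 :=
    Finset.sup_le fun i _ => hcard i
  exact Nat.sub_le_of_le_add this

end FinHypergraph

/-! ### Choosing a node and a family of clauses -/

namespace FinHypergraph

variable {V : Type*}

/-- Some node of the v-tree splits at least `treewidth / (3 * arity)` edges. -/
theorem exists_treewidth_le_card_splitEdges [Fintype V] (H : FinHypergraph V) {T : VTree V}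
    (hT : T.IsOver) :
    ∃ t, VTree.IsSubtree t T ∧ H.treewidth ≤ 3 * H.arity * (H.splitEdges t).card := by
  obtain ⟨t, ht, hmax⟩ := Set.exists_max_image {s | VTree.IsSubtree s T}
    (fun s => (H.splitEdges s).card) T.finite_isSubtree ⟨T, .refl T⟩
  exact ⟨t, ht, H.treewidth_le_of_splitEdges hT hmax⟩

/-- Some edge of `H` meets both `e` and `e'`. -/
def Linked (H : FinHypergraph V) (e e' : Finset V) : Prop :=
  ∃ f ∈ H.edges, (∃ x ∈ f, x ∈ e) ∧ ∃ x ∈ f, x ∈ e'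

open Classical in
theorem card_linked_le [Fintype V] [DecidableEq V] (H : FinHypergraph V) {e : Finset V}
    (he : e ∈ H.edges) :
    (H.edges.filter (H.Linked e)).card ≤ H.arity ^ 2 * H.degree ^ 2 := by
  have hdeg : ∀ v, (H.edges.filter fun f => v ∈ f).card ≤ H.degree := fun v =>
    Finset.le_sup (f := fun v => (H.edges.filter fun f => v ∈ f).card) (Finset.mem_univ v)
  have hmeet : ∀ e ∈ H.edges,
      (e.biUnion fun v => H.edges.filter fun f => v ∈ f).card ≤ H.arity * H.degree := fun e he =>
    (Finset.card_biUnion_le_card_mul _ _ _ fun v _ => hdeg v).trans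
      (Nat.mul_le_mul_right _ (card_le_arity he))
  have hsub : H.edges.filter (H.Linked e) ⊆
      (e.biUnion fun v => H.edges.filter fun f => v ∈ f).biUnion fun f =>
        f.biUnion fun v => H.edges.filter fun f => v ∈ f := by
    intro e' he'
    obtain ⟨he', f, hf, ⟨x, hxf, hxe⟩, y, hyf, hye⟩ := Finset.mem_filter.1 he'
    simp only [Finset.mem_biUnion, Finset.mem_filter]
    exact ⟨f, ⟨x, hxe, hf, hxf⟩, y, hyf, he', hye⟩
  calc _ ≤ _ := Finset.card_le_card hsub
    _ ≤ _ * (H.arity * H.degree) := Finset.card_biUnion_le_card_mul _ _ _ fun f hf => by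
        obtain ⟨v, -, hv⟩ := Finset.mem_biUnion.1 hf
        exact hmeet f (Finset.mem_filter.1 hv).1
    _ ≤ (H.arity * H.degree) * (H.arity * H.degree) := Nat.mul_le_mul_right _ (hmeet e he)
    _ = _ := by ring

/-- A maximal family of pairwise unlinked edges is large, as every edge is linked to one of its
members and no edge is linked to more than `(arity * degree) ^ 2` edges. -/
theorem exists_unlinked [Fintype V] [DecidableEq V] (H : FinHypergraph V)
    {F : Finset (Finset V)} (hF : F ⊆ H.edges) :
    ∃ K ⊆ F, (∀ e ∈ K, ∀ e' ∈ K, H.Linked e e' → e = e') ∧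
      F.card ≤ K.card * (H.arity ^ 2 * H.degree ^ 2) := by
  classical
  obtain ⟨K, hK, hmax⟩ := Finset.exists_max_image
    (F.powerset.filter fun K => ∀ e ∈ K, ∀ e' ∈ K, H.Linked e e' → e = e') Finset.card
    ⟨∅, by simp⟩
  obtain ⟨hKF, hind⟩ := Finset.mem_filter.1 hK
  rw [Finset.mem_powerset] at hKF
  refine ⟨K, hKF, hind, ?_⟩
  have hsymm : ∀ e e', H.Linked e e' → H.Linked e' e := fun e e' ⟨f, hf, h, h'⟩ =>
    ⟨f, hf, h', h⟩
  have hcover : F ⊆ K.biUnion fun e => H.edges.filter (H.Linked e) := by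
    intro e he
    simp only [Finset.mem_biUnion, Finset.mem_filter]
    by_contra! hno
    have heK : e ∉ K := fun h => by
      obtain ⟨x, hx⟩ := H.edge_nonempty e (hF he)
      exact hno e h (hF he) ⟨e, hF he, ⟨x, hx, hx⟩, x, hx, hx⟩
    have := hmax (insert e K) (Finset.mem_filter.2
      ⟨Finset.mem_powerset.2 (Finset.insert_subset he hKF), by
        intro a ha b hb hab
        rcases Finset.mem_insert.1 ha with rfl | haK <;>
          rcases Finset.mem_insert.1 hb with rfl | hbK
        · rfl
        · exact absurd (hsymm _ _ hab) (hno b hbK (hF he))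
        · exact absurd hab (hno a haK (hF he))
        · exact hind a haK b hbK hab⟩)
    rw [Finset.card_insert_of_notMem heK] at this
    omega
  exact (Finset.card_le_card hcover).trans
    (Finset.card_biUnion_le_card_mul _ _ _ fun e he => H.card_linked_le (hF (hKF he)))

end FinHypergraph

/-! ### Cutting a structured circuit -/

namespace BoolCircuit

variable {V G : Type*}

/-- A node of the v-tree structuring an AND-gate is either below `n`, so that the gate only
depends on the leaves of `n`, or has at most one child whose leaves meet those of `n`. -/
theorem cutsAlong_leaves [Finite G] {C : BoolCircuit V G} {T : VTree V} (hT : T.IsOver)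
    (hC : ∀ g, C.kind g = GateKind.and → (∃ h, C.wire h g) →
      ∃ n, VTree.IsSubtree n T ∧ C.StructuresGate n g)
    {n : VTree V} (hn : VTree.IsSubtree n T) : C.CutsAlong {v | v ∈ n.leaves} := by
  intro g hg hin
  obtain ⟨m, hm, inputs, -, hinputs, hall⟩ := hC g hg hin
  cases m with
  | leaf v =>
    cases hall
    obtain ⟨h, hw⟩ := hin
    simpa using (hinputs h).2 hw
  | unary t =>
    obtain ⟨h, l, -, hl, rfl⟩ := List.forall₂_cons_right_iff.1 hall
    cases hl
    refine Or.inr ⟨h, (hinputs h).1 (by simp), fun h' hw' hne => ?_⟩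
    exact absurd (by simpa using (hinputs h').2 hw') hne
  | node l r =>
    obtain ⟨h₁, _, hl, hrest, rfl⟩ := List.forall₂_cons_right_iff.1 hall
    obtain ⟨h₂, _, hr, hnil, rfl⟩ := List.forall₂_cons_right_iff.1 hrest
    cases hnil
    have hw₁ : C.wire h₁ g := (hinputs h₁).1 (by simp)
    have hw₂ : C.wire h₂ g := (hinputs h₂).1 (by simp)
    have hor : ∀ h, C.wire h g → h = h₁ ∨ h = h₂ := fun h hw => by
      simpa using (hinputs h).2 hw
    by_cases hdl : ∃ x ∈ l.leaves, x ∈ n.leaves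
    · by_cases hdr : ∃ x ∈ r.leaves, x ∈ n.leaves
      · left
        obtain ⟨x, hxl, hxn⟩ := hdl
        obtain ⟨y, hyr, hyn⟩ := hdr
        have hsub : VTree.IsSubtree (.node l r) n := by
          rcases hm.total hT.1 hn (v := x) (by simp [VTree.leaves, hxl]) hxn with h | h
          · exact h
          · cases h with
            | refl => exact .refl _
            | @child c _ hc hnc =>
              have hnd := hm.nodup hT.1
              have h1 := VTree.eq_of_mem_children hnd hc (by simp [VTree.children])
                (hnc.mem_leaves hxn) hxl
              have h2 := VTree.eq_of_mem_children hnd hc (by simp [VTree.children])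
                (hnc.mem_leaves hyn) hyr
              subst h1
              subst h2
              exact absurd rfl ((List.nodup_append.1 hnd).2.2 x hxl x hxl)
        intro v hv
        refine hsub.mem_leaves (List.mem_append.2 ?_)
        rcases mem_vars_iff.1 hv with h | ⟨h, hw, hv⟩
        · rw [hg] at h
          cases h
        · rcases hor h hw with rfl | rfl
          · exact Or.inl (hl v hv)
          · exact Or.inr (hr v hv)
      · refine Or.inr ⟨h₁, hw₁, fun h hw hne => ?_⟩
        obtain rfl := (hor h hw).resolve_left hne
        exact Set.disjoint_left.2 fun v hv hvn => hdr ⟨v, hr v hv, hvn⟩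
    · refine Or.inr ⟨h₂, hw₂, fun h hw hne => ?_⟩
      obtain rfl := (hor h hw).resolve_right hne
      exact Set.disjoint_left.2 fun v hv hvn => hdl ⟨v, hl v hv, hvn⟩

end BoolCircuit

/-! ### Split families of clauses -/

namespace MonotoneForm

variable {V : Type*} {φ : MonotoneForm V} {K : Finset (Finset V)} {X : Set V}

/-- The valuation `ν` gives to the variables of each clause `e` of `K` the truth value of `e ∈ S`
if they are in `X` and that of `e ∈ T` otherwise. The other variables are unconstrained. -/
def Encodes (K : Finset (Finset V)) (X : Set V) (S T : Set K) (ν : V → Bool) : Prop :=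
  ∀ e : K, ∀ v ∈ e.1, (v ∈ X → (ν v = true ↔ e ∈ S)) ∧ (v ∉ X → (ν v = true ↔ e ∈ T))

/-- Family of clauses of `φ` having vertices both in `X` and outside of `X`, such that no clause
meets two of them. -/
structure IsSplitFamily (φ : MonotoneForm V) (X : Set V) (K : Finset (Finset V)) : Prop where
  subset : K ⊆ φ.clauses
  inside : ∀ e ∈ K, ∃ x ∈ e, x ∈ X
  outside : ∀ e ∈ K, ∃ y ∈ e, y ∉ X
  unlinked : ∀ e ∈ K, ∀ e' ∈ K, φ.hypergraph.Linked e e' → e = e'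

theorem IsSplitFamily.eq_of_mem (hK : φ.IsSplitFamily X K) {e e' : Finset V} (he : e ∈ K)
    (he' : e' ∈ K) {v : V} (hv : v ∈ e) (hv' : v ∈ e') : e = e' :=
  hK.unlinked e he e' he' ⟨e, hK.subset he, ⟨v, hv, hv⟩, v, hv, hv'⟩

/-- As `φ` is minimized, a clause covered by `K` is a member of `K`. -/
theorem IsSplitFamily.mem_of_covered (hK : φ.IsSplitFamily X K) {D : Finset V}
    (hD : D ∈ φ.clauses) (hcov : ∀ v ∈ D, ∃ e ∈ K, v ∈ e) : D ∈ K := by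
  obtain ⟨v, hv⟩ := φ.hypergraph.edge_nonempty D hD
  obtain ⟨e, he, hve⟩ := hcov v hv
  have : D ⊆ e := fun w hw => by
    obtain ⟨e', he', hwe'⟩ := hcov w hw
    rwa [hK.unlinked e he e' he' ⟨D, hD, ⟨v, hv, hve⟩, w, hw, hwe'⟩]
  rwa [φ.minimized D hD e (hK.subset he) this]

/-- There are encodings of all pairs of sets in which all other variables have a prescribed
value, such that the values on `X` depend only on the first set and the values outside of `X` only
on the second one. -/
theorem IsSplitFamily.exists_encoding (hK : φ.IsSplitFamily X K) (d : Bool) :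
    ∃ ν : Set K → Set K → V → Bool, (∀ S T, Encodes K X S T (ν S T)) ∧
      (∀ S T v, (∀ e ∈ K, v ∉ e) → ν S T v = d) ∧
      (∀ S T T', ∀ v ∈ X, ν S T v = ν S T' v) ∧ (∀ S S' T, ∀ v ∉ X, ν S T v = ν S' T v) := by
  classical
  let ν : Set K → Set K → V → Bool := fun S T v =>
    if h : ∃ e : K, v ∈ e.1 then
      if v ∈ X then decide (h.choose ∈ S) else decide (h.choose ∈ T)
    else d
  refine ⟨ν, fun S T e v hv => ?_, fun S T v h => ?_, fun S T T' v hv => ?_,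
    fun S S' T v hv => ?_⟩
  · have h : ∃ e : K, v ∈ e.1 := ⟨e, hv⟩
    have heq : h.choose = e :=
      Subtype.ext (hK.eq_of_mem h.choose.2 e.2 h.choose_spec hv)
    constructor <;> intro hX <;> simp only [ν, dif_pos h, hX, heq] <;> simp
  · have h' : ¬ ∃ e : K, v ∈ e.1 := fun ⟨e, he⟩ => h e.1 e.2 he
    simp only [ν, dif_neg h']
  · simp only [ν, if_pos hv]
  · simp only [ν, if_neg hv]

theorem IsSplitFamily.dnfTrue_iff (hK : φ.IsSplitFamily X K) {S T : Set K} {ν : V → Bool}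
    (hν : Encodes K X S T ν) (hfalse : ∀ v, (∀ e ∈ K, v ∉ e) → ν v = false) :
    φ.dnfTrue ν ↔ (S ∩ T).Nonempty := by
  constructor
  · rintro ⟨D, hD, htrue⟩
    have hDK : D ∈ K := hK.mem_of_covered hD fun v hv => by
      by_contra! h
      simpa [hfalse v h] using htrue v hv
    obtain ⟨x, hx, hxX⟩ := hK.inside D hDK
    obtain ⟨y, hy, hyX⟩ := hK.outside D hDK
    exact ⟨⟨D, hDK⟩, ((hν ⟨D, hDK⟩ x hx).1 hxX).1 (htrue x hx),
      ((hν ⟨D, hDK⟩ y hy).2 hyX).1 (htrue y hy)⟩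
  · rintro ⟨e, heS, heT⟩
    refine ⟨e.1, hK.subset e.2, fun v hv => ?_⟩
    by_cases hX : v ∈ X
    · exact ((hν e v hv).1 hX).2 heS
    · exact ((hν e v hv).2 hX).2 heT

theorem IsSplitFamily.cnfTrue_iff (hK : φ.IsSplitFamily X K) {S T : Set K} {ν : V → Bool}
    (hν : Encodes K X S T ν) (htrue : ∀ v, (∀ e ∈ K, v ∉ e) → ν v = true) :
    φ.cnfTrue ν ↔ S ∪ T = Set.univ := by
  rw [Set.eq_univ_iff_forall]
  constructor
  · intro h e
    obtain ⟨v, hv, hvt⟩ := h e.1 (hK.subset e.2)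
    by_cases hX : v ∈ X
    · exact Or.inl (((hν e v hv).1 hX).1 hvt)
    · exact Or.inr (((hν e v hv).2 hX).1 hvt)
  · intro h D hD
    by_cases hcov : ∀ v ∈ D, ∃ e ∈ K, v ∈ e
    · have hDK := hK.mem_of_covered hD hcov
      rcases h ⟨D, hDK⟩ with hS | hT
      · obtain ⟨x, hx, hxX⟩ := hK.inside D hDK
        exact ⟨x, hx, ((hν ⟨D, hDK⟩ x hx).1 hxX).2 hS⟩
      · obtain ⟨y, hy, hyX⟩ := hK.outside D hDK
        exact ⟨y, hy, ((hν ⟨D, hDK⟩ y hy).2 hyX).2 hT⟩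
    · push Not at hcov
      obtain ⟨v, hv, hvK⟩ := hcov
      exact ⟨v, hv, htrue v hvK⟩

/-- Every v-tree has a node whose leaf set admits a large split family. -/
theorem exists_isSplitFamily [Fintype V] [DecidableEq V] (φ : MonotoneForm V) {T : VTree V}
    (hT : T.IsOver) :
    ∃ t K, VTree.IsSubtree t T ∧ φ.IsSplitFamily {v | v ∈ t.leaves} K ∧
      φ.hypergraph.treewidth /
        (3 * φ.hypergraph.arity ^ 3 * φ.hypergraph.degree ^ 2) ≤ K.card := by
  obtain ⟨t, ht, htw⟩ := φ.hypergraph.exists_treewidth_le_card_splitEdges hT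
  obtain ⟨K, hKF, hunl, hcard⟩ := φ.hypergraph.exists_unlinked
    (F := φ.hypergraph.splitEdges t) fun e he => (FinHypergraph.mem_splitEdges.1 he).1
  have hmem := fun e (he : e ∈ K) => FinHypergraph.mem_splitEdges.1 (hKF he)
  refine ⟨t, K, ht, ⟨fun e he => (hmem e he).1, fun e he => (hmem e he).2.1,
    fun e he => (hmem e he).2.2, hunl⟩, Nat.div_le_of_le_mul ?_⟩
  calc _ ≤ _ := htw
    _ ≤ _ := Nat.mul_le_mul_left _ hcard
    _ = _ := by ring

end MonotoneForm

/-- If `f` restricted to the encodings of pairs of subsets of a split family is the relation `R`,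
then a circuit that captures `f` and can be cut along `X` gives a decomposition of `R` into
`size`-many rectangles. -/
theorem BoolCircuit.exists_rectangles_sets {V G : Type*} [Finite G] {φ : MonotoneForm V}
    {K : Finset (Finset V)} {X : Set V} (hK : φ.IsSplitFamily X K) (hne : K.Nonempty)
    {C : BoolCircuit V G} (hC : C.IsNNF) (hX : C.CutsAlong X) {f : (V → Bool) → Prop}
    (hf : C.Captures f) {R : Set K → Set K → Prop} (d : Bool)
    (hR : ∀ S T ν, MonotoneForm.Encodes K X S T ν → (∀ v, (∀ e ∈ K, v ∉ e) → ν v = d) →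
      (f ν ↔ R S T)) :
    ∃ a b : G → Set K → Prop, (∀ S T, R S T ↔ ∃ u, a u S ∧ b u T) ∧
      (C.IsDeterministic → ∀ S T u u', a u S → b u T → a u' S → b u' T → u = u') := by
  obtain ⟨e, he⟩ := hne
  obtain ⟨y, -, hy⟩ := hK.outside e he
  obtain ⟨A, B, hA, hB, hAB, huniq⟩ := C.exists_rectangles hC hX hy hf
  obtain ⟨ν, hν, hd, hleft, hright⟩ := hK.exists_encoding d
  have hA' : ∀ u S T, A u (ν S ∅) ↔ A u (ν S T) := fun u S T => hA u _ _ (hleft S ∅ T)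
  have hB' : ∀ u S T, B u (ν ∅ T) ↔ B u (ν S T) := fun u S T => hB u _ _ (hright ∅ S T)
  refine ⟨fun u S => A u (ν S ∅), fun u T => B u (ν ∅ T), fun S T => ?_,
    fun hdet S T u u' => ?_⟩
  · rw [← hR S T _ (hν S T) (hd S T), hAB]
    simp only [hA' _ S T, hB' _ S T]
  · beta_reduce
    rw [hA' u S T, hA' u' S T, hB' u S T, hB' u' S T]
    exact huniq hdet _ u u'

/-! ### The lower bound -/

theorem mainTheorem2 {V : Type*} [Fintype V] [DecidableEq V] (φ : MonotoneForm V)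
    {G : Type*} [Fintype G] (C : BoolCircuit V G) :
    (C.IsDSDNNF → C.Captures φ.dnfTrue →
      2 ^ (φ.hypergraph.treewidth /
        (3 * φ.hypergraph.arity ^ 3 * φ.hypergraph.degree ^ 2)) - 1 ≤ C.size) ∧
    (C.IsSDNNF → C.Captures φ.cnfTrue →
      2 ^ (φ.hypergraph.treewidth /
        (3 * φ.hypergraph.arity ^ 3 * φ.hypergraph.degree ^ 2)) - 1 ≤ C.size) := by
  constructor
  · rintro ⟨⟨hnnf, -, T, hT, hstr⟩, hdet⟩ hcap
    obtain ⟨t, K, ht, hK, hcard⟩ := φ.exists_isSplitFamily hT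
    refine (Nat.sub_le_sub_right (Nat.pow_le_pow_right two_pos hcard) 1).trans ?_
    rcases K.eq_empty_or_nonempty with rfl | hne
    · simp
    obtain ⟨a, b, hab, huniq⟩ := BoolCircuit.exists_rectangles_sets hK hne hnnf
      (BoolCircuit.cutsAlong_leaves hT hstr ht) hcap false fun S T ν => hK.dnfTrue_iff
    have := two_pow_card_le_of_disjoint_rectangles a b hab (huniq hdet)
    rw [Fintype.card_coe] at this
    exact Nat.sub_le_of_le_add this
  · rintro ⟨hnnf, -, T, hT, hstr⟩ hcap
    obtain ⟨t, K, ht, hK, hcard⟩ := φ.exists_isSplitFamily hT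
    refine (Nat.sub_le_sub_right (Nat.pow_le_pow_right two_pos hcard) 1).trans ?_
    rcases K.eq_empty_or_nonempty with rfl | hne
    · simp
    obtain ⟨a, b, hab, -⟩ := BoolCircuit.exists_rectangles_sets hK hne hnnf
      (BoolCircuit.cutsAlong_leaves hT hstr ht) hcap true fun S T ν => hK.cnfTrue_iff
    have := two_pow_card_le_of_rectangles a b hab
    rw [Fintype.card_coe] at this
    exact (Nat.sub_le _ _).trans this
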